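/- Let $k>2$ and $D\ge 2k+1$ be integers, with indices taking $D$ values. Consider the real graded-commutative polynomial algebra $\mathcal A$ generated by the following tensors together with all their commuting spacetime derivatives (coefficients are constant, no explicit dependence on the coordinates): the field $t_{\mu_1\cdots\mu_k|\nu_1\cdots\nu_k}$ (even); the ghosts $\eta^{(m)}_{\mu_1\cdots\mu_k|\nu_1\cdots\nu_{k-m-1}}$, $0\le m\le k-1$ (parity $m+1$ mod 2); and the antifields $\chi^*$, namely $t^{*\mu_1\cdots\mu_k|\nu_1\cdots\nu_k}$ (odd, antighost number $1$) and $\eta^{*(m)\mu_1\cdots\mu_k|\nu_1\cdots\nu_{k-m-1}}$, $0\le m\le k-1$ (parity $m$ mod 2, antighost number $m+2$). Field and ghosts have antighost number $0$. Each of these tensors is antisymmetric in the $\mu$'s and in the $\nu$'s and vanishes upon antisymmetrization over all the $\mu$'s and one $\nu$ (if there is one); $t$ and $t^*$ are moreover symmetric under the interchange of the two sets of indices. Let $$F_{\mu_1\cdots\mu_{k+1}|\nu_1\cdots\nu_{k+1}}=\partial_{[\mu_1}t_{\mu_2\cdots\mu_{k+1}]|[\nu_2\cdots\nu_{k+1},\nu_1]}$$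 be the curvature tensor, where $f_{,\nu}=\partial_\nu f$ and the brackets denote antisymmetrization over distinct terms. A local $p$-form is a $p$-form in $dx^0,\dots,dx^{D-1}$ with coefficients in $\mathcal A$, and $d=dx^\mu\partial_\mu$, where the derivation $\partial_\mu$ is the total derivative. An invariant polynomial (of form degree $p$) is a local $p$-form whose coefficients are polynomials $\alpha([\chi^*],[F])$ in the antifields, the curvature tensor and their derivatives. There are no forms of degree $-1$ (so $d\beta=0$ for $\beta$ of degree $-1$). Let $j>0$. (i) If $p<D$ and $\alpha$ is an invariant polynomial of form degree $p$ and antighost number $j$ with $d\alpha=0$, then $\alpha=d\beta$ for some invariant polynomial $\beta$ of form degree $p-1$ and antighost number $j$. (ii) If $\alpha$ is an invariant polynomial of form degree $D$ and antighost number $j$, and $\alpha=d\beta$ for some local $(D-1)$-form $\beta$ (with coefficients in $\mathcal A$), then $\alpha=d\beta'$ for some invariant polynomial $\beta'$ of form degree $D-1$ and antighost number $j$. -/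

import Mathlib

namespace MixedTensor

/-- The species of generators of the BRST algebra of a tensor field with the mixed symmetry
`(k, k)`: the field `t`, the ghosts `η⁽ᵐ⁾`, and the antifields `t*`, `η*⁽ᵐ⁾`, `0 ≤ m ≤ k - 1`. -/
inductive Species (k : ℕ) : Type
  | t : Species k
  | ghost (m : Fin k) : Species k
  | tStar : Species k
  | ghostStar (m : Fin k) : Species k

namespace Species

variable {k : ℕ}

/-- Length of the second column of the Young diagram (the first one always has length `k`). -/
def col : Species k → ℕ
  | t => k
  | ghost m => k - m - 1
  | tStar => k
  | ghostStar m => k - m - 1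

/-- Grassmann parity (to be read modulo 2). -/
def parity : Species k → ℕ
  | t => 0
  | ghost m => m + 1
  | tStar => 1
  | ghostStar m => m

/-- Antighost number. -/
def agh : Species k → ℕ
  | t => 0
  | ghost _ => 0
  | tStar => 1
  | ghostStar m => m + 2

/-- The antifields `χ*` are `t*` and all the `η*⁽ᵐ⁾`. -/
def IsAntifield : Species k → Prop
  | t => False
  | ghost _ => False
  | tStar => True
  | ghostStar _ => True

end Species

/-- A jet variable `∂_{ρ₁} ⋯ ∂_{ρₙ} φ_{μ₁ ⋯ μ_k | ν₁ ⋯ ν_b}`: a component of one of the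
(anti)fields together with a multiset `ρ` of derivative indices (derivatives commute).
Indices take `D` values. -/
structure Gen (k D : ℕ) : Type where
  species : Species k
  μ : Fin k → Fin D
  ν : Fin species.col → Fin D
  ρ : Multiset (Fin D)

namespace Gen

variable {k D : ℕ}

/-- The antighost number of a jet variable. -/
def agh (g : Gen k D) : ℕ := g.species.agh

/-- Adding one derivative `∂_σ`. -/
def deriv (σ : Fin D) (g : Gen k D) : Gen k D := { g with ρ := σ ::ₘ g.ρ }

end Gen

/-- The defining relations of the BRST algebra: the mixed symmetry of the generators, also
after differentiation, and graded commutativity. -/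
inductive Rel (k D : ℕ) : FreeAlgebra ℝ (Gen k D) → FreeAlgebra ℝ (Gen k D) → Prop
  /-- antisymmetry in the first column -/
  | antisymm_left (s : Species k) (μ : Fin k → Fin D) (ν : Fin s.col → Fin D)
      (ρ : Multiset (Fin D)) (τ : Equiv.Perm (Fin k)) :
      Rel k D (FreeAlgebra.ι ℝ ⟨s, μ ∘ τ, ν, ρ⟩)
        (((Equiv.Perm.sign τ : ℤ) : ℝ) • FreeAlgebra.ι ℝ ⟨s, μ, ν, ρ⟩)
  /-- antisymmetry in the second column -/
  | antisymm_right (s : Species k) (μ : Fin k → Fin D) (ν : Fin s.col → Fin D)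
      (ρ : Multiset (Fin D)) (τ : Equiv.Perm (Fin s.col)) :
      Rel k D (FreeAlgebra.ι ℝ ⟨s, μ, ν ∘ τ, ρ⟩)
        (((Equiv.Perm.sign τ : ℤ) : ℝ) • FreeAlgebra.ι ℝ ⟨s, μ, ν, ρ⟩)
  /-- algebraic Bianchi identity: antisymmetrization over the `k` indices of the first column
  and the index in any one slot `c` of the second column vanishes; `κ` collects these `k + 1`
  indices, and the value of `ν` in the slot `c` is irrelevant -/
  | bianchi (s : Species k) (κ : Fin (k + 1) → Fin D) (ν : Fin s.col → Fin D) (c : Fin s.col)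
      (ρ : Multiset (Fin D)) :
      Rel k D (∑ i : Fin (k + 1), ((-1 : ℝ) ^ (i : ℕ)) •
        FreeAlgebra.ι ℝ ⟨s, κ ∘ i.succAbove, Function.update ν c (κ i), ρ⟩) 0
  /-- symmetry of `t` under the interchange of the two columns -/
  | swap_t (μ ν : Fin k → Fin D) (ρ : Multiset (Fin D)) :
      Rel k D (FreeAlgebra.ι ℝ ⟨.t, μ, ν, ρ⟩) (FreeAlgebra.ι ℝ ⟨.t, ν, μ, ρ⟩)
  /-- symmetry of `t*` under the interchange of the two columns -/
  | swap_tStar (μ ν : Fin k → Fin D) (ρ : Multiset (Fin D)) :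
      Rel k D (FreeAlgebra.ι ℝ ⟨.tStar, μ, ν, ρ⟩) (FreeAlgebra.ι ℝ ⟨.tStar, ν, μ, ρ⟩)
  /-- graded commutativity -/
  | comm (g h : Gen k D) :
      Rel k D (FreeAlgebra.ι ℝ g * FreeAlgebra.ι ℝ h)
        (((-1 : ℝ) ^ (g.species.parity * h.species.parity)) •
          (FreeAlgebra.ι ℝ h * FreeAlgebra.ι ℝ g))

/-- The BRST algebra: the graded commutative algebra of real polynomials in the field, the
ghosts, the antifields and their spacetime derivatives. -/
def BRST (k D : ℕ) : Type := RingQuot (Rel k D)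

noncomputable instance (k D : ℕ) : Ring (BRST k D) := inferInstanceAs (Ring (RingQuot _))
noncomputable instance (k D : ℕ) : Algebra ℝ (BRST k D) :=
  inferInstanceAs (Algebra ℝ (RingQuot _))

variable {k D : ℕ}

namespace BRST

/-- The quotient map. -/
noncomputable def mk : FreeAlgebra ℝ (Gen k D) →ₐ[ℝ] BRST k D :=
  RingQuot.mkAlgHom ℝ (Rel k D)

theorem mk_rel {x y : FreeAlgebra ℝ (Gen k D)} (h : Rel k D x y) : mk x = mk y :=
  RingQuot.mkAlgHom_rel ℝ h

theorem mk_surjective : Function.Surjective (mk : FreeAlgebra ℝ (Gen k D) →ₐ[ℝ] BRST k D) :=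
  RingQuot.mkAlgHom_surjective ℝ (Rel k D)

/-- The universal property of the quotient. -/
noncomputable def lift {B : Type*} [Semiring B] [Algebra ℝ B] (f : FreeAlgebra ℝ (Gen k D) →ₐ[ℝ] B)
    (h : ∀ ⦃x y⦄, Rel k D x y → f x = f y) : BRST k D →ₐ[ℝ] B :=
  RingQuot.liftAlgHom ℝ ⟨f, h⟩

theorem lift_mk {B : Type*} [Semiring B] [Algebra ℝ B] (f : FreeAlgebra ℝ (Gen k D) →ₐ[ℝ] B)
    (h : ∀ ⦃x y⦄, Rel k D x y → f x = f y) (x : FreeAlgebra ℝ (Gen k D)) :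
    lift f h (mk x) = f x :=
  RingQuot.liftAlgHom_mkAlgHom_apply ℝ f h x

end BRST

/-- The jet variable `g` as an element of the BRST algebra. -/
noncomputable def X (g : Gen k D) : BRST k D := BRST.mk (FreeAlgebra.ι ℝ g)

/-- Two algebra morphisms out of the BRST algebra that agree on the jet variables are equal. -/
theorem BRST.algHom_ext {B : Type*} [Semiring B] [Algebra ℝ B] {f g : BRST k D →ₐ[ℝ] B}
    (h : ∀ x, f (X x) = g (X x)) : f = g := by
  have e : f.comp mk = g.comp mk := FreeAlgebra.hom_ext (funext h)
  ext x
  obtain ⟨x, rfl⟩ := mk_surjective x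
  exact DFunLike.congr_fun e x

/-- `a ↦ a + ε ∂_σ a` on the free algebra, with `ε² = 0`. -/
noncomputable def totalDerivAux (σ : Fin D) :
    FreeAlgebra ℝ (Gen k D) →ₐ[ℝ] DualNumber (BRST k D) :=
  FreeAlgebra.lift ℝ fun g => TrivSqZeroExt.inl (X g) + TrivSqZeroExt.inr (X (g.deriv σ))

theorem totalDerivAux_rel (σ : Fin D) {x y : FreeAlgebra ℝ (Gen k D)} (h : Rel k D x y) :
    totalDerivAux σ x = totalDerivAux σ y := by
  have key : ∀ g : Gen k D, totalDerivAux σ (FreeAlgebra.ι ℝ g) =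
      TrivSqZeroExt.inl (X g) + TrivSqZeroExt.inr (X (g.deriv σ)) := fun g => by
    simp [totalDerivAux]
  cases h with
  | antisymm_left s μ ν ρ τ =>
    rw [map_smul, key, key]
    ext
    · simpa [X] using BRST.mk_rel (Rel.antisymm_left s μ ν ρ τ)
    · simpa [X, Gen.deriv] using BRST.mk_rel (Rel.antisymm_left s μ ν (σ ::ₘ ρ) τ)
  | antisymm_right s μ ν ρ τ =>
    rw [map_smul, key, key]
    ext
    · simpa [X] using BRST.mk_rel (Rel.antisymm_right s μ ν ρ τ)
    · simpa [X, Gen.deriv] using BRST.mk_rel (Rel.antisymm_right s μ ν (σ ::ₘ ρ) τ)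
  | bianchi s κ ν c ρ =>
    simp only [map_sum, map_smul, key, map_zero]
    ext
    · simpa [X, TrivSqZeroExt.fst_sum] using BRST.mk_rel (Rel.bianchi s κ ν c ρ)
    · simpa [X, TrivSqZeroExt.snd_sum, Gen.deriv] using BRST.mk_rel (Rel.bianchi s κ ν c (σ ::ₘ ρ))
  | swap_t μ ν ρ =>
    rw [key, key]
    ext
    · simpa [X] using BRST.mk_rel (Rel.swap_t μ ν ρ)
    · simpa [X, Gen.deriv] using BRST.mk_rel (Rel.swap_t μ ν (σ ::ₘ ρ))
  | swap_tStar μ ν ρ =>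
    rw [key, key]
    ext
    · simpa [X] using BRST.mk_rel (Rel.swap_tStar μ ν ρ)
    · simpa [X, Gen.deriv] using BRST.mk_rel (Rel.swap_tStar μ ν (σ ::ₘ ρ))
  | comm g h =>
    have e : ∀ a b : Gen k D, X a * X b =
        ((-1 : ℝ) ^ (a.species.parity * b.species.parity)) • (X b * X a) := fun a b => by
      simpa [X] using BRST.mk_rel (Rel.comm a b)
    rw [map_smul, map_mul, map_mul, key, key]
    ext
    · simpa using e g h
    · have h1 := e g (h.deriv σ)
      have h2 := e (g.deriv σ) h
      simp only [Gen.deriv] at h1 h2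
      simp [Gen.deriv, h1, h2, add_comm]

/-- `a ↦ a + ε ∂_σ a` on the BRST algebra, with `ε² = 0`. -/
noncomputable def totalDerivHom (σ : Fin D) : BRST k D →ₐ[ℝ] DualNumber (BRST k D) :=
  BRST.lift (totalDerivAux σ) fun _ _ h => totalDerivAux_rel σ h

/-- The spacetime derivative `∂_σ`: the (even) derivation of the BRST algebra that adds a
derivative index `σ` to the jet variables. -/
noncomputable def totalDeriv (σ : Fin D) : BRST k D →ₗ[ℝ] BRST k D :=
  (TrivSqZeroExt.sndHom (BRST k D) (BRST k D)).restrictScalars ℝ ∘ₗ (totalDerivHom σ).toLinearMap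

/-- `∂_σ ∂_ρ φ = ∂_{σ ρ} φ`. -/
theorem totalDeriv_X (σ : Fin D) (g : Gen k D) : totalDeriv σ (X g) = X (g.deriv σ) := by
  simp [totalDeriv, totalDerivHom, X, BRST.lift_mk, totalDerivAux]

/-- The Leibniz rule. -/
theorem totalDeriv_mul (σ : Fin D) (a b : BRST k D) :
    totalDeriv σ (a * b) = a * totalDeriv σ b + totalDeriv σ a * b := by
  have hf : (TrivSqZeroExt.fstHom ℝ (BRST k D) (BRST k D)).comp (totalDerivHom σ) =
      AlgHom.id ℝ (BRST k D) := by
    apply BRST.algHom_ext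
    intro x
    simp [totalDerivHom, X, BRST.lift_mk, totalDerivAux]
  have hfst : ∀ c : BRST k D, (totalDerivHom σ c).fst = c := fun c => DFunLike.congr_fun hf c
  simp [totalDeriv, TrivSqZeroExt.snd_mul, hfst]

/-- `∂_{ρ₁} ⋯ ∂_{ρₙ} F_{μ₁ ⋯ μ_{k+1} | ν₁ ⋯ ν_{k+1}}`, where
`F_{μ₁ ⋯ μ_{k+1} | ν₁ ⋯ ν_{k+1}} = ∂_{[μ₁} t_{μ₂ ⋯ μ_{k+1}] | [ν₂ ⋯ ν_{k+1}, ν₁]}`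
is the curvature tensor (antisymmetrizations over distinct terms, without normalization). -/
noncomputable def curvature (μ ν : Fin (k + 1) → Fin D) (ρ : Multiset (Fin D)) : BRST k D :=
  ∑ i : Fin (k + 1), ∑ j : Fin (k + 1), ((-1 : ℝ) ^ ((i : ℕ) + (j : ℕ))) •
    X ⟨.t, μ ∘ i.succAbove, ν ∘ j.succAbove, μ i ::ₘ ν j ::ₘ ρ⟩

theorem totalDeriv_curvature (σ : Fin D) (μ ν : Fin (k + 1) → Fin D) (ρ : Multiset (Fin D)) :
    totalDeriv σ (curvature (k := k) μ ν ρ) = curvature μ ν (σ ::ₘ ρ) := by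
  simp only [curvature, map_sum, map_smul, totalDeriv_X, Gen.deriv]
  refine Finset.sum_congr rfl fun i _ => Finset.sum_congr rfl fun j _ => ?_
  rw [Multiset.cons_swap σ (μ i), Multiset.cons_swap σ (ν j)]

/-- Elements of antighost number `j`: the linear combinations of monomials in the jet variables
whose antighost numbers add up to `j`. -/
noncomputable def aghPart (k D j : ℕ) : Submodule ℝ (BRST k D) :=
  Submodule.span ℝ {a | ∃ l : List (Gen k D), (l.map Gen.agh).sum = j ∧ (l.map X).prod = a}

/-- The invariant polynomials `α([χ*], [F])`: polynomials in the antifields, the curvature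
tensor and all their derivatives. -/
noncomputable def invPoly (k D : ℕ) : Subalgebra ℝ (BRST k D) :=
  Algebra.adjoin ℝ
    ({a | ∃ g : Gen k D, g.species.IsAntifield ∧ X g = a} ∪
      {a | ∃ (μ ν : Fin (k + 1) → Fin D) (ρ : Multiset (Fin D)), curvature μ ν ρ = a})

/-- Local forms of form degree `p`: alternating `p`-linear maps on the translation vectors
with values in the BRST algebra, i.e. `∑ ρ_{μ₁ ⋯ μ_p} dx^{μ₁} ∧ ⋯ ∧ dx^{μ_p}`. -/
abbrev Form (k D p : ℕ) : Type := (Fin D → ℝ) [⋀^Fin p]→ₗ[ℝ] BRST k D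

/-- The directional derivative `v ↦ v^σ ∂_σ ω` of the coefficients of a form. -/
noncomputable def gradForm {p : ℕ} (ω : Form k D p) : (Fin D → ℝ) →ₗ[ℝ] Form k D p :=
  ∑ σ : Fin D, (LinearMap.proj σ : (Fin D → ℝ) →ₗ[ℝ] ℝ).smulRight
    ((totalDeriv σ).compAlternatingMap ω)

/-- The exterior spacetime differential `d = dx^σ ∂_σ`. -/
noncomputable def extD {p : ℕ} (ω : Form k D p) : Form k D (p + 1) :=
  AlternatingMap.alternatizeUncurryFin (gradForm ω)

/-- `(dω)(v₀, …, v_p) = ∑ᵢ (-1)ⁱ vᵢ^σ ∂_σ (ω(v₀, …, v̂ᵢ, …, v_p))`. -/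
theorem extD_apply {p : ℕ} (ω : Form k D p) (v : Fin (p + 1) → Fin D → ℝ) :
    extD ω v = ∑ i : Fin (p + 1), (-1 : ℝ) ^ (i : ℕ) •
      ∑ σ : Fin D, v i σ • totalDeriv σ (ω (i.removeNth v)) := by
  simp only [extD, gradForm, AlternatingMap.alternatizeUncurryFin_apply, LinearMap.sum_apply,
    LinearMap.smulRight_apply, LinearMap.proj_apply]
  refine Finset.sum_congr rfl fun i _ => ?_
  have e : ∀ (f : Fin D → Form k D p) (w : Fin p → Fin D → ℝ), (∑ σ, f σ) w = ∑ σ, f σ w :=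
    fun f w => map_sum (AddMonoidHom.mk' (fun a : Form k D p => a w) fun _ _ => rfl) f _
  rw [e, ← Int.cast_smul_eq_zsmul ℝ]
  push_cast
  rfl

/-- The invariant `p`-forms of antighost number `j`: all their coefficients are invariant
polynomials of antighost number `j`. -/
noncomputable def invForm (k D j p : ℕ) : Submodule ℝ (Form k D p) where
  carrier := {ω | ∀ v, ω v ∈ invPoly k D ∧ ω v ∈ aghPart k D j}
  add_mem' ha hb v := ⟨add_mem (ha v).1 (hb v).1, add_mem (ha v).2 (hb v).2⟩
  zero_mem' _ := ⟨zero_mem _, zero_mem _⟩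
  smul_mem' c _ ha v := ⟨Subalgebra.smul_mem _ (ha v).1 c, Submodule.smul_mem _ c (ha v).2⟩

/-- `ω = dβ` for some `β` in the given space of forms of one degree less; as there are no forms
of degree `-1`, a `0`-form is exact only if it vanishes. -/
def IsExactIn (S : ∀ p : ℕ, Submodule ℝ (Form k D p)) : ∀ {p : ℕ}, Form k D p → Prop
  | 0, ω => ω = 0
  | p + 1, ω => ∃ β ∈ S p, extD β = ω

end MixedTensor

/-!
The proof is a homotopy argument with the full differential `d`; neither a basis of the BRST
algebra nor the identities satisfied by the curvature enter.

Besides the total derivatives `∂_σ`, the BRST algebra carries the derivations `Δ^τ` (`lower τ`),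
which remove one derivative `∂_τ` from the antifields with the antighost number as weight and kill
the field and the ghosts, and `N` (`numAgh`), which counts the antighost number. They satisfy
`[Δ^τ, ∂_σ] = δ^τ_σ N` and `[N, ∂_σ] = 0` (`lower_totalDeriv`, `numAgh_totalDeriv`). As `Δ^τ` kills
the curvature, all these operators preserve the invariant polynomials of antighost number `j`, on
which `N` is the number `j > 0`. The contraction `h = ι_τ Δ^τ` then satisfies
`d h + h d = A + (D - p) N` on `p`-forms, where `A = ∑ ∂_σ Δ^σ` (`extD_homotopy_add`); hence on
closed invariant forms `A` is `-(D - p) j` modulo differentials of invariant forms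
(`osc_add_smul_mem_exactInv`).

On the other hand the `Δ^τ` are locally nilpotent, and normal ordering gives
`A (A - N) ⋯ (A - (m - 1) N) = ∑ ∂_{σ₁} ⋯ ∂_{σₘ} Δ^{σₘ} ⋯ Δ^{σ₁}` (`osc_normalPow`), so that every
form is killed by such a product. If `α` is closed and invariant with `p < D`, the factors are
the scalars `-(D - p + m) j ≠ 0` modulo exact invariant forms, so `α` itself is exact
(`mem_exactInv_of_lt`). If `p = D` and `α = d β` with `β` arbitrary, then `A d = d (A + N)` turns
the product for `β` into `(A - N) (A - 2 N) ⋯ (A - m N) α = 0`; the vanishing factor `A` is absent,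
and since `A` is `0` modulo exact invariant forms in degree `D`, the factors are again nonzero
scalars (`mem_exactInv_top`).
-/

namespace MixedTensor

variable {k D : ℕ}

/-! ### Derivations of the BRST algebra -/

/-- `f` is an even derivation of the BRST algebra: the Leibniz rule without signs. (The ring is not
commutative, so `Derivation` does not apply.) -/
def IsDer (f : Module.End ℝ (BRST k D)) : Prop :=
  ∀ a b, f (a * b) = a * f b + f a * b

theorem IsDer.map_one {f : Module.End ℝ (BRST k D)} (hf : IsDer f) : f 1 = 0 := by
  simpa using hf 1 1

theorem IsDer.commutator {f g : Module.End ℝ (BRST k D)} (hf : IsDer f) (hg : IsDer g) :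
    IsDer (f * g - g * f) := by
  intro a b
  simp only [LinearMap.sub_apply, Module.End.mul_apply, hf _ _, hg _ _, map_add]
  noncomm_ring

theorem IsDer.smul {f : Module.End ℝ (BRST k D)} (hf : IsDer f) (c : ℝ) : IsDer (c • f) := by
  intro a b
  simp [hf a b]

theorem isDer_totalDeriv (σ : Fin D) : IsDer (k := k) (totalDeriv σ) := totalDeriv_mul σ

/-- The monomials in the jet variables span the BRST algebra. -/
theorem span_monomial_eq_top :
    Submodule.span ℝ (Set.range fun l : List (Gen k D) => (l.map X).prod) = ⊤ := by
  have h : Algebra.adjoin ℝ (Set.range (X : Gen k D → BRST k D)) = ⊤ := by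
    refine eq_top_iff.2 fun x _ => ?_
    obtain ⟨y, rfl⟩ := BRST.mk_surjective x
    induction y using FreeAlgebra.induction with
    | grade0 r => simp
    | grade1 g => exact Algebra.subset_adjoin ⟨g, rfl⟩
    | mul a b ha hb => rw [map_mul]; exact mul_mem (ha trivial) (hb trivial)
    | add a b ha hb => rw [map_add]; exact add_mem (ha trivial) (hb trivial)
  refine eq_top_iff.2 ?_
  rw [← Algebra.top_toSubmodule, ← h, Algebra.adjoin_eq_span]
  refine Submodule.span_mono fun x hx => ?_
  obtain ⟨l, hl, rfl⟩ := Submonoid.exists_list_of_mem_closure hx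
  obtain ⟨l', rfl⟩ : ∃ l' : List (Gen k D), l'.map X = l := by
    have h' : l ∈ Set.range (List.map (X : Gen k D → BRST k D)) := by
      rw [Set.range_list_map]
      exact hl
    exact h'
  exact ⟨l', rfl⟩

theorem IsDer.ext {f g : Module.End ℝ (BRST k D)} (hf : IsDer f) (hg : IsDer g)
    (h : ∀ x, f (X x) = g (X x)) : f = g := by
  refine LinearMap.ext_on_range span_monomial_eq_top fun l => ?_
  induction l with
  | nil => simp [hf.map_one, hg.map_one]
  | cons x l ih => simp [hf _ _, hg _ _, h, ih]

/-- `a ↦ a + ε f(a)` on the free algebra, with `ε² = 0`, where `f` is the derivation with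
`f(∂_ρ φ) = w(φ, ρ) ∂_{e(ρ)} φ`. -/
noncomputable def jetDerAux (w : Species k → Multiset (Fin D) → ℝ)
    (e : Multiset (Fin D) → Multiset (Fin D)) :
    FreeAlgebra ℝ (Gen k D) →ₐ[ℝ] DualNumber (BRST k D) :=
  FreeAlgebra.lift ℝ fun g => TrivSqZeroExt.inl (X g) +
    TrivSqZeroExt.inr (w g.species g.ρ • X { g with ρ := e g.ρ })

theorem jetDerAux_rel (w : Species k → Multiset (Fin D) → ℝ)
    (e : Multiset (Fin D) → Multiset (Fin D)) {x y : FreeAlgebra ℝ (Gen k D)} (h : Rel k D x y) :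
    jetDerAux w e x = jetDerAux w e y := by
  have key : ∀ g : Gen k D, jetDerAux w e (FreeAlgebra.ι ℝ g) = TrivSqZeroExt.inl (X g) +
      TrivSqZeroExt.inr (w g.species g.ρ • X { g with ρ := e g.ρ }) := fun g => by
    simp [jetDerAux]
  cases h with
  | antisymm_left s μ ν ρ τ =>
    rw [map_smul, key, key]
    ext
    · simpa [X] using BRST.mk_rel (Rel.antisymm_left s μ ν ρ τ)
    · simpa [X, smul_comm (w s ρ)] using
        congrArg (w s ρ • ·) (BRST.mk_rel (Rel.antisymm_left s μ ν (e ρ) τ))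
  | antisymm_right s μ ν ρ τ =>
    rw [map_smul, key, key]
    ext
    · simpa [X] using BRST.mk_rel (Rel.antisymm_right s μ ν ρ τ)
    · simpa [X, smul_comm (w s ρ)] using
        congrArg (w s ρ • ·) (BRST.mk_rel (Rel.antisymm_right s μ ν (e ρ) τ))
  | bianchi s κ ν c ρ =>
    simp only [map_sum, map_smul, key, map_zero]
    ext
    · simpa [X, TrivSqZeroExt.fst_sum] using BRST.mk_rel (Rel.bianchi s κ ν c ρ)
    · simpa [X, TrivSqZeroExt.snd_sum, Finset.smul_sum, smul_comm (w s ρ)] using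
        congrArg (w s ρ • ·) (BRST.mk_rel (Rel.bianchi s κ ν c (e ρ)))
  | swap_t μ ν ρ =>
    rw [key, key]
    ext
    · simpa [X] using BRST.mk_rel (Rel.swap_t μ ν ρ)
    · simpa [X] using congrArg (w .t ρ • ·) (BRST.mk_rel (Rel.swap_t μ ν (e ρ)))
  | swap_tStar μ ν ρ =>
    rw [key, key]
    ext
    · simpa [X] using BRST.mk_rel (Rel.swap_tStar μ ν ρ)
    · simpa [X] using congrArg (w .tStar ρ • ·) (BRST.mk_rel (Rel.swap_tStar μ ν (e ρ)))
  | comm g h =>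
    have c : ∀ a b : Gen k D, X a * X b =
        ((-1 : ℝ) ^ (a.species.parity * b.species.parity)) • (X b * X a) := fun a b => by
      simpa [X] using BRST.mk_rel (Rel.comm a b)
    rw [map_smul, map_mul, map_mul, key, key]
    ext
    · simpa using c g h
    · have h1 := c g { h with ρ := e h.ρ }
      have h2 := c { g with ρ := e g.ρ } h
      simp only at h1 h2
      simp only [TrivSqZeroExt.snd_mul, TrivSqZeroExt.snd_smul, TrivSqZeroExt.fst_add,
        TrivSqZeroExt.snd_add, TrivSqZeroExt.fst_inl, TrivSqZeroExt.fst_inr,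
        TrivSqZeroExt.snd_inl, TrivSqZeroExt.snd_inr, add_zero, zero_add, smul_eq_mul,
        MulOpposite.smul_eq_mul_unop, MulOpposite.unop_op, mul_smul_comm, smul_mul_assoc, h1, h2,
        smul_add, smul_comm (w _ _)]
      rw [add_comm]

/-- The derivation of the BRST algebra with `∂_ρ φ ↦ w(φ, ρ) ∂_{e(ρ)} φ` on the jet variables.
It exists because the relations do not mix the species and do not involve `ρ`. -/
noncomputable def jetDer (w : Species k → Multiset (Fin D) → ℝ)
    (e : Multiset (Fin D) → Multiset (Fin D)) : Module.End ℝ (BRST k D) :=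
  (TrivSqZeroExt.sndHom (BRST k D) (BRST k D)).restrictScalars ℝ ∘ₗ
    (BRST.lift (jetDerAux w e) fun _ _ h => jetDerAux_rel w e h).toLinearMap

theorem jetDer_X (w : Species k → Multiset (Fin D) → ℝ)
    (e : Multiset (Fin D) → Multiset (Fin D)) (g : Gen k D) :
    jetDer w e (X g) = w g.species g.ρ • X { g with ρ := e g.ρ } := by
  simp [jetDer, X, BRST.lift_mk, jetDerAux]

theorem isDer_jetDer (w : Species k → Multiset (Fin D) → ℝ)
    (e : Multiset (Fin D) → Multiset (Fin D)) : IsDer (jetDer w e) := by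
  have hf : (TrivSqZeroExt.fstHom ℝ (BRST k D) (BRST k D)).comp
      (BRST.lift (jetDerAux w e) fun _ _ h => jetDerAux_rel w e h) = AlgHom.id ℝ (BRST k D) := by
    apply BRST.algHom_ext
    intro x
    simp [X, BRST.lift_mk, jetDerAux]
  have hfst : ∀ c : BRST k D,
      (BRST.lift (jetDerAux w e) (fun _ _ h => jetDerAux_rel w e h) c).fst = c :=
    fun c => DFunLike.congr_fun hf c
  intro a b
  simp [jetDer, TrivSqZeroExt.snd_mul, hfst]

/-- The derivation that multiplies a jet variable by its antighost number. -/
noncomputable def numAgh : Module.End ℝ (BRST k D) := jetDer (fun s _ => s.agh) id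

/-- The derivation that removes one derivative `∂_τ` from the antifields (in all possible ways),
weighted with the antighost number; it kills the field and the ghosts. -/
noncomputable def lower (τ : Fin D) : Module.End ℝ (BRST k D) :=
  jetDer (fun s ρ => s.agh * ρ.count τ) (·.erase τ)

theorem lower_X (τ : Fin D) (g : Gen k D) : lower τ (X g) =
    ((g.species.agh : ℝ) * g.ρ.count τ) • X { g with ρ := g.ρ.erase τ } := jetDer_X _ _ _

theorem isDer_lower (τ : Fin D) : IsDer (lower (k := k) τ) := isDer_jetDer _ _

theorem numAgh_X (g : Gen k D) : numAgh (X g) = (g.species.agh : ℝ) • X g := jetDer_X _ _ _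

theorem isDer_numAgh : IsDer (numAgh (k := k) (D := D)) := isDer_jetDer _ _

/-- The commutation relation `[Δ^τ, ∂_σ] = δ^τ_σ N`. The weight of `Δ^τ` on a jet variable is its
antighost number times the multiplicity of `τ`, and `∂_σ` raises the latter by `δ^τ_σ`. -/
theorem lower_totalDeriv (σ τ : Fin D) (a : BRST k D) :
    lower τ (totalDeriv σ a) = totalDeriv σ (lower τ a) + if τ = σ then numAgh a else 0 := by
  have h : lower (k := k) τ * totalDeriv σ - totalDeriv σ * lower τ =
      (if τ = σ then (1 : ℝ) else 0) • numAgh := by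
    refine ((isDer_lower τ).commutator (isDer_totalDeriv σ)).ext (isDer_numAgh.smul _) fun g => ?_
    simp only [LinearMap.sub_apply, Module.End.mul_apply, LinearMap.smul_apply, totalDeriv_X,
      lower_X, numAgh_X, map_smul, Gen.deriv]
    split_ifs with e
    · subst e
      by_cases hm : τ ∈ g.ρ
      · simp only [Multiset.erase_cons_head, Multiset.count_cons_self, Multiset.cons_erase hm]
        rw [← sub_smul, one_smul]
        congr 1
        push_cast
        ring
      · simp [Multiset.count_eq_zero_of_notMem hm]
    · rw [Multiset.count_cons_of_ne e, Multiset.erase_cons_tail _ (Ne.symm e)]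
      simp
  have h' := LinearMap.congr_fun h a
  simp only [LinearMap.sub_apply, Module.End.mul_apply, LinearMap.smul_apply] at h'
  rw [← sub_eq_iff_eq_add', h']
  split_ifs <;> simp

theorem totalDeriv_comm (σ τ : Fin D) (a : BRST k D) :
    totalDeriv σ (totalDeriv τ a) = totalDeriv τ (totalDeriv σ a) := by
  have h : totalDeriv (k := k) σ * totalDeriv τ - totalDeriv τ * totalDeriv σ =
      (0 : ℝ) • numAgh := by
    refine ((isDer_totalDeriv σ).commutator (isDer_totalDeriv τ)).ext (isDer_numAgh.smul _)
      fun g => ?_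
    simp [totalDeriv_X, Gen.deriv, Multiset.cons_swap σ τ]
  have h' := LinearMap.congr_fun h a
  simpa [sub_eq_zero] using h'

theorem numAgh_totalDeriv (σ : Fin D) (a : BRST k D) :
    numAgh (totalDeriv σ a) = totalDeriv σ (numAgh a) := by
  have h : numAgh (k := k) * totalDeriv σ - totalDeriv σ * numAgh = (0 : ℝ) • numAgh := by
    refine (isDer_numAgh.commutator (isDer_totalDeriv σ)).ext (isDer_numAgh.smul _) fun g => ?_
    simp [totalDeriv_X, numAgh_X, Gen.deriv]
  have h' := LinearMap.congr_fun h a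
  simpa [sub_eq_zero] using h'

/-! ### The oscillator algebra and normal ordering -/

/-- The operator `∑_σ ∂_σ Δ^σ`, where `Δ^σ` is `lower σ`. -/
noncomputable def osc : Module.End ℝ (BRST k D) := ∑ σ, totalDeriv σ * lower σ

theorem osc_apply (a : BRST k D) : osc a = ∑ σ, totalDeriv σ (lower σ a) := by
  simp [osc, LinearMap.sum_apply]

/-- `A ∂_τ = ∂_τ (A + N)` for `A = ∑ ∂_σ Δ^σ`. -/
theorem osc_totalDeriv (τ : Fin D) (a : BRST k D) :
    osc (totalDeriv τ a) = totalDeriv τ (osc a + numAgh a) := by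
  simp only [osc_apply, lower_totalDeriv, map_add, map_sum, Finset.sum_add_distrib,
    totalDeriv_comm τ]
  congr 1
  rw [Finset.sum_eq_single τ] <;> simp +contextual

/-- The normally ordered power
`∑ ∂_{σ₁} ⋯ ∂_{σₘ} Δ^{σₘ} ⋯ Δ^{σ₁}` of `osc`. -/
noncomputable def normalPow : ℕ → Module.End ℝ (BRST k D)
  | 0 => 1
  | m + 1 => ∑ σ, totalDeriv σ * normalPow m * lower σ

theorem normalPow_zero (a : BRST k D) : normalPow 0 a = a := rfl

theorem normalPow_succ (m : ℕ) (a : BRST k D) :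
    normalPow (m + 1) a = ∑ σ, totalDeriv σ (normalPow m (lower σ a)) := by
  simp [normalPow, LinearMap.sum_apply]

/-- Normal ordering: the `(m + 1)`-st normally ordered power of `A = ∑ ∂_σ Δ^σ` is `A - m N` times
the `m`-th one. -/
theorem osc_normalPow (m : ℕ) (a : BRST k D) :
    osc (normalPow m a) = normalPow (m + 1) a + (m : ℝ) • numAgh (normalPow m a) := by
  induction m generalizing a with
  | zero => simp [normalPow_succ, normalPow_zero, osc_apply]
  | succ m ih =>
    rw [normalPow_succ, map_sum, normalPow_succ (m + 1), map_sum, Finset.smul_sum,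
      ← Finset.sum_add_distrib]
    refine Finset.sum_congr rfl fun σ _ => ?_
    rw [osc_totalDeriv, ih, numAgh_totalDeriv]
    simp only [map_add, map_smul]
    push_cast
    module

theorem map_mem_of_mem_span (f : Module.End ℝ (BRST k D)) {S : Set (BRST k D)}
    {B : Submodule ℝ (BRST k D)} (h : ∀ a ∈ S, f a ∈ B) {a : BRST k D}
    (ha : a ∈ Submodule.span ℝ S) : f a ∈ B :=
  Submodule.map_le_iff_le_comap.1 ((Submodule.map_span_le f S B).2 h) ha

/-- A derivation that lowers a weight of the jet variables by `s` lowers the weight of every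
monomial by `s` (to be read as killing the monomials of weight less than `s`). -/
theorem IsDer.map_monomial_mem {f : Module.End ℝ (BRST k D)} (hf : IsDer f) (wt : Gen k D → ℕ)
    (s : ℕ) (h : ∀ g, f (X g) ∈ Submodule.span ℝ
      {a | ∃ l : List (Gen k D), (l.map wt).sum + s = wt g ∧ (l.map X).prod = a})
    (l : List (Gen k D)) : f (l.map X).prod ∈ Submodule.span ℝ
      {a | ∃ l' : List (Gen k D), (l'.map wt).sum + s = (l.map wt).sum ∧ (l'.map X).prod = a} := by
  induction l with
  | nil => simp [hf.map_one]
  | cons g l ih =>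
    rw [List.map_cons, List.map_cons, List.prod_cons, List.sum_cons, hf]
    refine add_mem ?_ ?_
    · refine map_mem_of_mem_span (LinearMap.mulLeft ℝ (X g)) ?_ ih
      rintro _ ⟨l', hl, rfl⟩
      exact Submodule.subset_span ⟨g :: l', by simp; omega, by simp⟩
    · refine map_mem_of_mem_span (LinearMap.mulRight ℝ (l.map X).prod) ?_ (h g)
      rintro _ ⟨l', hl, rfl⟩
      exact Submodule.subset_span ⟨l' ++ l, by simp; omega, by simp⟩

theorem normalPow_monomial_eq_zero (m : ℕ) (l : List (Gen k D))
    (hl : (l.map fun g => g.ρ.card).sum < m) : normalPow m (l.map X).prod = 0 := by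
  induction m generalizing l with
  | zero => omega
  | succ m ih =>
    rw [normalPow_succ]
    refine Finset.sum_eq_zero fun σ _ => ?_
    have h := (isDer_lower (k := k) σ).map_monomial_mem (fun g => g.ρ.card) 1 (fun g => ?_) l
    · have h0 : normalPow m (lower σ (l.map X).prod) = 0 := by
        refine (Submodule.mem_bot ℝ).1 (map_mem_of_mem_span _ ?_ h)
        rintro _ ⟨l', hl', rfl⟩
        exact ih l' (by omega)
      rw [h0, map_zero]
    · rw [lower_X]
      by_cases hm : σ ∈ g.ρ
      · refine Submodule.smul_mem _ _ (Submodule.subset_span ⟨[{ g with ρ := g.ρ.erase σ }], ?_, ?_⟩)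
        · simpa using Multiset.card_erase_add_one hm
        · simp
      · simp [Multiset.count_eq_zero_of_notMem hm]

theorem normalPow_eq_zero_of_le {m n : ℕ} (h : m ≤ n) {a : BRST k D} (ha : normalPow m a = 0) :
    normalPow n a = 0 := by
  induction n, h using Nat.le_induction with
  | base => exact ha
  | succ n _ ih => simpa [ih] using (osc_normalPow n a).symm

/-- Each `Δ^σ` removes one derivative, so long words in them kill a given polynomial. -/
theorem exists_normalPow_eq_zero (a : BRST k D) : ∃ m, normalPow m a = 0 := by
  have ha : a ∈ Submodule.span ℝ (Set.range fun l : List (Gen k D) => (l.map X).prod) := by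
    rw [span_monomial_eq_top]; trivial
  induction ha using Submodule.span_induction with
  | mem x hx =>
    obtain ⟨l, rfl⟩ := hx
    exact ⟨_, normalPow_monomial_eq_zero _ l (Nat.lt_succ_self _)⟩
  | zero => exact ⟨0, map_zero _⟩
  | add x y _ _ hx hy =>
    obtain ⟨m, hm⟩ := hx
    obtain ⟨n, hn⟩ := hy
    exact ⟨max m n, by rw [map_add, normalPow_eq_zero_of_le (le_max_left m n) hm,
      normalPow_eq_zero_of_le (le_max_right m n) hn, add_zero]⟩
  | smul c x _ hx =>
    obtain ⟨m, hm⟩ := hx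
    exact ⟨m, by rw [map_smul, hm, smul_zero]⟩

/-! ### Invariant polynomials of given antighost number -/

theorem numAgh_of_mem_aghPart {j : ℕ} {a : BRST k D} (ha : a ∈ aghPart k D j) :
    numAgh a = (j : ℝ) • a := by
  have h : ∀ l : List (Gen k D),
      numAgh (l.map X).prod = (((l.map Gen.agh).sum : ℕ) : ℝ) • (l.map X).prod := by
    intro l
    induction l with
    | nil => simp [isDer_numAgh.map_one]
    | cons g l ih =>
      rw [List.map_cons, List.prod_cons, isDer_numAgh, ih, numAgh_X, List.map_cons, List.sum_cons,
        mul_smul_comm, smul_mul_assoc, ← add_smul, add_comm]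
      push_cast
      rfl
  induction ha using Submodule.span_induction with
  | mem x hx =>
    obtain ⟨l, rfl, rfl⟩ := hx
    exact h l
  | zero => simp
  | add x y _ _ hx hy => rw [map_add, hx, hy, smul_add]
  | smul c x _ hx => rw [map_smul, hx, smul_comm]

theorem IsDer.map_mem_aghPart {f : Module.End ℝ (BRST k D)} (hf : IsDer f)
    (h : ∀ g, ∃ (c : ℝ) (ρ : Multiset (Fin D)), f (X g) = c • X { g with ρ := ρ }) {j : ℕ}
    {a : BRST k D} (ha : a ∈ aghPart k D j) : f a ∈ aghPart k D j := by
  refine map_mem_of_mem_span f ?_ ha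
  rintro _ ⟨l, rfl, rfl⟩
  refine hf.map_monomial_mem Gen.agh 0 (fun g => ?_) l
  obtain ⟨c, ρ, e⟩ := h g
  rw [e]
  exact Submodule.smul_mem _ _ (Submodule.subset_span ⟨[{ g with ρ := ρ }], by simp [Gen.agh],
    by simp⟩)

theorem IsDer.map_mem_invPoly {f : Module.End ℝ (BRST k D)} (hf : IsDer f)
    (hX : ∀ g : Gen k D, g.species.IsAntifield → f (X g) ∈ invPoly k D)
    (hF : ∀ (μ ν : Fin (k + 1) → Fin D) (ρ : Multiset (Fin D)),
      f (curvature μ ν ρ) ∈ invPoly k D)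
    {a : BRST k D} (ha : a ∈ invPoly k D) : f a ∈ invPoly k D := by
  induction ha using Algebra.adjoin_induction with
  | mem x hx =>
    rcases hx with ⟨g, hg, rfl⟩ | ⟨μ, ν, ρ, rfl⟩
    · exact hX g hg
    · exact hF μ ν ρ
  | algebraMap r =>
    rw [Algebra.algebraMap_eq_smul_one, map_smul, hf.map_one, smul_zero]
    exact zero_mem _
  | add x y _ _ hx hy => rw [map_add]; exact add_mem hx hy
  | mul x y hx' hy' hx hy => rw [hf]; exact add_mem (mul_mem hx' hy) (mul_mem hx hy')

theorem X_mem_invPoly {g : Gen k D} (hg : g.species.IsAntifield) : X g ∈ invPoly k D :=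
  Algebra.subset_adjoin (.inl ⟨g, hg, rfl⟩)

/-- The invariant polynomials of antighost number `j`. -/
noncomputable def invAgh (k D j : ℕ) : Submodule ℝ (BRST k D) :=
  Subalgebra.toSubmodule (invPoly k D) ⊓ aghPart k D j

theorem totalDeriv_mem_invAgh {j : ℕ} (σ : Fin D) {a : BRST k D} (ha : a ∈ invAgh k D j) :
    totalDeriv σ a ∈ invAgh k D j := by
  refine ⟨(isDer_totalDeriv σ).map_mem_invPoly (fun g hg => ?_) (fun μ ν ρ => ?_) ha.1,
    (isDer_totalDeriv σ).map_mem_aghPart (fun g => ⟨1, σ ::ₘ g.ρ, ?_⟩) ha.2⟩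
  · rw [totalDeriv_X]
    exact X_mem_invPoly hg
  · rw [totalDeriv_curvature]
    exact Algebra.subset_adjoin (.inr ⟨μ, ν, _, rfl⟩)
  · rw [totalDeriv_X, one_smul]
    rfl

theorem lower_mem_invAgh {j : ℕ} (σ : Fin D) {a : BRST k D} (ha : a ∈ invAgh k D j) :
    lower σ a ∈ invAgh k D j := by
  refine ⟨(isDer_lower σ).map_mem_invPoly (fun g hg => ?_) (fun μ ν ρ => ?_) ha.1,
    (isDer_lower σ).map_mem_aghPart (fun g => ⟨_, _, lower_X σ g⟩) ha.2⟩
  · rw [lower_X]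
    exact Subalgebra.smul_mem _ (X_mem_invPoly (g := { g with ρ := g.ρ.erase σ }) hg) _
  · have h : lower σ (curvature (k := k) μ ν ρ) = 0 := by
      simp [curvature, lower_X, Species.agh]
    rw [h]
    exact zero_mem _

theorem osc_mem_invAgh {j : ℕ} {a : BRST k D} (ha : a ∈ invAgh k D j) : osc a ∈ invAgh k D j := by
  rw [osc_apply]
  exact sum_mem fun σ _ => totalDeriv_mem_invAgh σ (lower_mem_invAgh σ ha)

/-! ### The homotopy on local forms -/

/-- `extD` as a linear map. -/
noncomputable def extDLin (p : ℕ) : Form k D p →ₗ[ℝ] Form k D (p + 1) where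
  toFun := extD
  map_add' a b := by
    ext v
    simp [extD_apply, Finset.sum_add_distrib, smul_add]
  map_smul' c a := by
    ext v
    simp only [extD_apply, AlternatingMap.smul_apply, map_smul, RingHom.id_apply, Finset.smul_sum]
    simp only [smul_comm c]

/-- An endomorphism of the BRST algebra acting on the coefficients of a form. -/
noncomputable def coeffMap {p : ℕ} (f : Module.End ℝ (BRST k D)) : Module.End ℝ (Form k D p) where
  toFun ω := f.compAlternatingMap ω
  map_add' a b := by ext v; simp
  map_smul' c a := by ext v; simp

@[simp] theorem coeffMap_apply {p : ℕ} (f : Module.End ℝ (BRST k D)) (ω : Form k D p)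
    (v : Fin p → Fin D → ℝ) : coeffMap f ω v = f (ω v) := rfl

/-- The contracting operator `h = ι_τ Δ^τ`: contraction with the `τ`-th coordinate vector
combined with `lower τ`. -/
noncomputable def homotopy {p : ℕ} (ω : Form k D (p + 1)) : Form k D p :=
  ∑ τ : Fin D, coeffMap (lower τ) (AlternatingMap.curryLeft ω (Pi.single τ 1))

theorem homotopy_apply {p : ℕ} (ω : Form k D (p + 1)) (v : Fin p → Fin D → ℝ) :
    homotopy ω v = ∑ τ : Fin D, lower τ (ω (Fin.cons (Pi.single τ 1) v)) := by
  have e : ∀ (f : Fin D → Form k D p), (∑ σ, f σ) v = ∑ σ, f σ v :=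
    fun f => map_sum (AddMonoidHom.mk' (fun a : Form k D p => a v) fun _ _ => rfl) f _
  rw [homotopy, e]
  rfl

theorem homotopy_mem_invForm {j p : ℕ} {ω : Form k D (p + 1)} (h : ω ∈ invForm k D j (p + 1)) :
    homotopy ω ∈ invForm k D j p := by
  intro v
  rw [homotopy_apply]
  exact Submodule.sum_mem (invAgh k D j) fun τ _ => lower_mem_invAgh τ (h _)

/-- `A d = d (A + N)`. -/
theorem coeffMap_osc_extD {p : ℕ} (ω : Form k D p) :
    coeffMap osc (extD ω) = extD (coeffMap osc ω + coeffMap numAgh ω) := by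
  ext v
  simp only [coeffMap_apply, extD_apply, map_sum, map_smul, osc_totalDeriv,
    AlternatingMap.add_apply]

theorem coeffMap_numAgh_extD {p : ℕ} (ω : Form k D p) :
    coeffMap numAgh (extD ω) = extD (coeffMap numAgh ω) := by
  ext v
  simp only [coeffMap_apply, extD_apply, map_sum, map_smul, numAgh_totalDeriv]

/-- The operator `h d`, with the summand of `d` that differentiates along the contracted vector
split off and reordered by the commutation relation. -/
theorem homotopy_extD_apply {p : ℕ} (ω : Form k D p) (v : Fin p → Fin D → ℝ) :
    homotopy (extD ω) v = osc (ω v) + (D : ℝ) • numAgh (ω v) -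
      ∑ i : Fin p, (-1 : ℝ) ^ (i : ℕ) • ∑ τ : Fin D, ∑ σ : Fin D, v i σ •
        lower τ (totalDeriv σ (ω (i.succ.removeNth
          (Fin.cons (Pi.single τ 1) v : Fin (p + 1) → Fin D → ℝ)))) := by
  have h (τ : Fin D) : ∑ σ : Fin D, (Pi.single τ (1 : ℝ) : Fin D → ℝ) σ • totalDeriv σ (ω v) =
      totalDeriv τ (ω v) := by
    rw [Finset.sum_eq_single τ] <;> simp +contextual
  simp only [homotopy_apply, extD_apply, Fin.sum_univ_succ, Fin.cons_zero, Fin.removeNth_zero,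
    Fin.tail_cons, Fin.val_zero, pow_zero, one_smul, h, map_add, Finset.sum_add_distrib,
    lower_totalDeriv, if_true, osc_apply, Finset.sum_const, Finset.card_univ, Fintype.card_fin,
    Fin.cons_succ, Fin.val_succ, pow_succ, mul_neg_one, neg_smul, Finset.sum_neg_distrib, map_neg,
    map_sum, map_smul, Finset.smul_sum, Nat.cast_smul_eq_nsmul, sub_eq_add_neg]
  congr 2
  rw [Finset.sum_comm]

/-- In degree zero only the term `h d` of the homotopy formula is present. -/
theorem homotopy_extD_zero (ω : Form k D 0) :
    homotopy (extD ω) = coeffMap osc ω + (D : ℝ) • coeffMap numAgh ω := by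
  ext v
  simp [homotopy_extD_apply]

/-- The homotopy formula `d h + h d = ∑ ∂_σ Δ^σ + (D - p) N` on `p`-forms, where `N` is the
antighost number. -/
theorem extD_homotopy_add {p : ℕ} (ω : Form k D (p + 1)) :
    extD (homotopy ω) + homotopy (extD ω) =
      coeffMap osc ω + ((D : ℝ) - (p + 1)) • coeffMap numAgh ω := by
  ext v
  have hrem (i : Fin (p + 1)) (τ : Fin D) :
      i.succ.removeNth (Fin.cons (Pi.single τ 1) v : Fin (p + 2) → Fin D → ℝ) =
        Fin.cons (Pi.single τ 1) (i.removeNth v) := by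
    funext m
    refine Fin.cases ?_ (fun m => ?_) m <;> simp [Fin.removeNth]
  -- Contracting with all coordinate vectors replaces `v i` by itself, up to the sign that moves it
  -- back to the slot `i`.
  have hexp (i : Fin (p + 1)) : ∑ τ : Fin D, v i τ •
      numAgh (ω (Fin.cons (Pi.single τ 1) (i.removeNth v))) =
        (-1 : ℝ) ^ (i : ℕ) • numAgh (ω v) := by
    have h1 : ω (Fin.cons (v i) (i.removeNth v)) = (-1 : ℝ) ^ (i : ℕ) • ω v := by
      have := ω.neg_one_pow_smul_map_insertNth i (v i) (i.removeNth v)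
      rw [Fin.insertNth_self_removeNth] at this
      refine Eq.trans this.symm ?_
      rw [← Int.cast_smul_eq_zsmul ℝ]
      push_cast
      rfl
    have h2 : ω (Fin.cons (v i) (i.removeNth v)) =
        ∑ τ : Fin D, v i τ • ω (Fin.cons (Pi.single τ 1) (i.removeNth v)) := by
      have h3 := LinearMap.pi_apply_eq_sum_univ
        (ω.toMultilinearMap.toLinearMap (Fin.cons 0 (i.removeNth v)) 0) (v i)
      have hs (τ : Fin D) : (fun σ => if τ = σ then (1 : ℝ) else 0) = Pi.single τ 1 := by
        ext σ
        simp [Pi.single_apply, eq_comm]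
      simp only [hs] at h3
      simpa [Fin.update_cons_zero] using h3
    rw [← map_smul, ← h1, h2, map_sum]
    simp only [map_smul]
  have hN : ∑ i : Fin (p + 1), (-1 : ℝ) ^ (i : ℕ) • ∑ τ : Fin D, v i τ •
      numAgh (ω (Fin.cons (Pi.single τ 1) (i.removeNth v))) =
        ((p : ℝ) + 1) • numAgh (ω v) := by
    simp only [hexp, smul_smul, ← mul_pow]
    simp [← Nat.cast_smul_eq_nsmul ℝ]
  have hswap : ∑ i : Fin (p + 1), (-1 : ℝ) ^ (i : ℕ) • ∑ τ : Fin D, ∑ σ : Fin D, v i σ •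
        lower τ (totalDeriv σ (ω (i.succ.removeNth
          (Fin.cons (Pi.single τ 1) v : Fin (p + 2) → Fin D → ℝ)))) =
      extD (homotopy ω) v + ((p : ℝ) + 1) • numAgh (ω v) := by
    rw [← hN, extD_apply, ← Finset.sum_add_distrib]
    refine Finset.sum_congr rfl fun i _ => ?_
    rw [← smul_add]
    congr 1
    simp only [hrem, lower_totalDeriv, smul_add, Finset.sum_add_distrib, homotopy_apply, map_sum,
      Finset.smul_sum]
    congr 1
    · exact Finset.sum_comm
    · refine Finset.sum_congr rfl fun τ _ => ?_
      rw [Finset.sum_eq_single τ] <;> simp +contextual [eq_comm]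
  simp only [AlternatingMap.add_apply, AlternatingMap.smul_apply, coeffMap_apply,
    homotopy_extD_apply, hswap]
  module

/-! ### Exactness -/

/-- The differentials of invariant forms of antighost number `j`; there are none in degree `0`. -/
noncomputable def exactInv (k D j : ℕ) : ∀ p : ℕ, Submodule ℝ (Form k D p)
  | 0 => ⊥
  | p + 1 => (invForm k D j p).map (extDLin p)

theorem isExactIn_of_mem_exactInv {j : ℕ} : ∀ {p : ℕ} {ω : Form k D p}, ω ∈ exactInv k D j p →
    IsExactIn (invForm k D j) ω
  | 0, _, h => h
  | _ + 1, _, ⟨β, hβ, h⟩ => ⟨β, hβ, h⟩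

theorem coeffMap_numAgh_of_mem_invForm {j p : ℕ} {ω : Form k D p} (h : ω ∈ invForm k D j p) :
    coeffMap numAgh ω = (j : ℝ) • ω := by
  ext v
  exact numAgh_of_mem_aghPart (h v).2

theorem coeffMap_osc_mem_invForm {j p : ℕ} {ω : Form k D p} (h : ω ∈ invForm k D j p) :
    coeffMap osc ω ∈ invForm k D j p := fun v => osc_mem_invAgh (h v)

theorem extD_coeffMap_osc {p : ℕ} {ω : Form k D p} (h : extD ω = 0) :
    extD (coeffMap osc ω) = 0 := by
  have h1 := coeffMap_osc_extD ω
  have h2 := coeffMap_numAgh_extD ω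
  have h3 := map_add (extDLin (k := k) (D := D) p) (coeffMap osc ω) (coeffMap numAgh ω)
  simp only [h, map_zero] at h1 h2
  change extD _ = extD _ + extD _ at h3
  rwa [← h1, ← h2, add_zero, eq_comm] at h3

/-- On closed invariant `p`-forms, `∑ ∂_σ Δ^σ` acts as `-(D - p) j` up to exact terms. -/
theorem osc_add_smul_mem_exactInv {j p : ℕ} {ω : Form k D p} (h : ω ∈ invForm k D j p)
    (hd : extD ω = 0) :
    coeffMap osc ω + (((D : ℝ) - p) * j) • ω ∈ exactInv k D j p := by
  have h0 {q : ℕ} : homotopy (0 : Form k D (q + 1)) = 0 := by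
    ext v
    simp [homotopy_apply]
  rw [mul_smul, ← coeffMap_numAgh_of_mem_invForm h]
  cases p with
  | zero =>
    have e := homotopy_extD_zero ω
    rw [hd, h0] at e
    rw [Nat.cast_zero, sub_zero, ← e]
    exact zero_mem _
  | succ p =>
    have e := extD_homotopy_add ω
    rw [hd, h0, add_zero] at e
    rw [Nat.cast_succ, ← e]
    exact ⟨_, homotopy_mem_invForm h, rfl⟩

/-- A sequence that is multiplied by nonzero scalars modulo `B` and ends with zero starts in `B`. -/
theorem mem_of_succ_add_smul_mem {V : Type*} [AddCommGroup V] [Module ℝ V] (B : Submodule ℝ V)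
    (α : ℕ → V) (c : ℕ → ℝ) (hc : ∀ m, c m ≠ 0) (h : ∀ m, α (m + 1) + c m • α m ∈ B) {M : ℕ}
    (hM : α M = 0) : α 0 ∈ B := by
  have key : ∀ m, α m ∈ B → α 0 ∈ B := by
    intro m
    induction m with
    | zero => exact id
    | succ m ih =>
      exact fun hm => ih ((B.smul_mem_iff (hc m)).1 ((B.add_mem_iff_right hm).1 (h m)))
  exact key M (hM ▸ zero_mem B)

theorem exists_coeffMap_normalPow_eq_zero {p : ℕ} (ω : Form k D p) :
    ∃ m, coeffMap (normalPow m) ω = 0 := by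
  choose m hm using fun i : Fin p → Fin D =>
    exists_normalPow_eq_zero (ω fun s => Pi.basisFun ℝ (Fin D) (i s))
  -- A form has finitely many independent coefficients, so one exponent serves for all of them.
  refine ⟨Finset.univ.sup m, Module.Basis.ext_alternating (Pi.basisFun ℝ (Fin D)) fun i _ => ?_⟩
  exact normalPow_eq_zero_of_le (Finset.le_sup (Finset.mem_univ i)) (hm i)

theorem coeffMap_normalPow_succ (m : ℕ) {p : ℕ} (ω : Form k D p) :
    coeffMap (normalPow (m + 1)) ω = coeffMap osc (coeffMap (normalPow m) ω) -
      (m : ℝ) • coeffMap numAgh (coeffMap (normalPow m) ω) := by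
  ext v
  simp [osc_normalPow]

/-- A closed invariant form of degree `p < D` and positive antighost number is the differential
of an invariant form. -/
theorem mem_exactInv_of_lt {j p : ℕ} (hj : 0 < j) (hp : p < D) {α : Form k D p}
    (hα : α ∈ invForm k D j p) (hd : extD α = 0) : α ∈ exactInv k D j p := by
  obtain ⟨M, hM⟩ := exists_coeffMap_normalPow_eq_zero α
  have hZ (m : ℕ) : coeffMap (normalPow m) α ∈ invForm k D j p ∧
      extD (coeffMap (normalPow m) α) = 0 := by
    induction m with
    | zero => exact ⟨hα, hd⟩
    | succ m ih =>
      rw [coeffMap_normalPow_succ, coeffMap_numAgh_of_mem_invForm ih.1]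
      refine ⟨sub_mem (coeffMap_osc_mem_invForm ih.1)
        (Submodule.smul_mem _ _ (Submodule.smul_mem _ _ ih.1)), ?_⟩
      have h1 : extDLin p (coeffMap osc (coeffMap (normalPow m) α)) = 0 := extD_coeffMap_osc ih.2
      have h2 : extDLin p (coeffMap (normalPow m) α) = 0 := ih.2
      change extDLin p _ = 0
      simp [h1, h2]
  have hpD : (p : ℝ) < D := Nat.cast_lt.2 hp
  have hj' : (0 : ℝ) < j := Nat.cast_pos.2 hj
  refine mem_of_succ_add_smul_mem (exactInv k D j p) (fun m => coeffMap (normalPow m) α)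
    (fun m => (m + (D - p)) * j) (fun m => ?_) (fun m => ?_) hM
  · exact (mul_pos (add_pos_of_nonneg_of_pos m.cast_nonneg (sub_pos.2 hpD)) hj').ne'
  · have h := osc_add_smul_mem_exactInv (hZ m).1 (hZ m).2
    rw [coeffMap_normalPow_succ, coeffMap_numAgh_of_mem_invForm (hZ m).1]
    convert h using 1
    module

/-- An invariant form of top degree and positive antighost number which is the differential of
some local form is the differential of an invariant one. -/
theorem mem_exactInv_top {j p : ℕ} (hj : 0 < j) (β : Form k (p + 1) p)
    (hα : extD β ∈ invForm k (p + 1) j (p + 1)) : extD β ∈ exactInv k (p + 1) j (p + 1) := by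
  -- `d P_m β = (A - N) ⋯ (A - m N) d β`, where `P_m` is `normalPow m`.
  obtain ⟨M, hM⟩ := exists_coeffMap_normalPow_eq_zero β
  -- There are no nonzero forms of degree greater than the dimension.
  have hd (ω : Form k (p + 1) (p + 1)) : extD ω = 0 := by
    ext v
    refine AlternatingMap.map_linearDependent _ v fun hv => ?_
    simpa using hv.fintype_card_le_finrank
  have hsucc (m : ℕ) : extD (coeffMap (normalPow (m + 1)) β) =
      coeffMap osc (extD (coeffMap (normalPow m) β)) -
        ((m : ℝ) + 1) • coeffMap numAgh (extD (coeffMap (normalPow m) β)) := by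
    have h (ω : Form k (p + 1) p) : extD ω = extDLin p ω := rfl
    rw [coeffMap_osc_extD, coeffMap_numAgh_extD, coeffMap_normalPow_succ, h, h, h, map_sub,
      map_add, map_smul]
    module
  have hZ (m : ℕ) : extD (coeffMap (normalPow m) β) ∈ invForm k (p + 1) j (p + 1) := by
    induction m with
    | zero => exact hα
    | succ m ih =>
      rw [hsucc, coeffMap_numAgh_of_mem_invForm ih]
      exact sub_mem (coeffMap_osc_mem_invForm ih)
        (Submodule.smul_mem _ _ (Submodule.smul_mem _ _ ih))
  have hj' : (0 : ℝ) < j := Nat.cast_pos.2 hj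
  refine mem_of_succ_add_smul_mem (exactInv k (p + 1) j (p + 1))
    (fun m => extD (coeffMap (normalPow m) β)) (fun m => (m + 1) * j) (fun m => ?_) (fun m => ?_)
    (M := M) ?_
  · positivity
  · have h := osc_add_smul_mem_exactInv (hZ m) (hd _)
    rw [hsucc, coeffMap_numAgh_of_mem_invForm (hZ m)]
    rw [sub_self, zero_mul, zero_smul, add_zero] at h
    convert h using 1
    module
  · rw [hM]
    exact map_zero (extDLin p)

end MixedTensor

theorem mainTheorem4 (k D : ℕ) (hk : 2 < k) (hD : 2 * k + 1 ≤ D) (j : ℕ) (hj : 0 < j) :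
    (∀ p : ℕ, p < D → ∀ α ∈ MixedTensor.invForm k D j p, MixedTensor.extD α = 0 →
      MixedTensor.IsExactIn (MixedTensor.invForm k D j) α) ∧
    (∀ α ∈ MixedTensor.invForm k D j D,
      MixedTensor.IsExactIn (fun _ => (⊤ : Submodule ℝ (MixedTensor.Form k D _))) α →
      MixedTensor.IsExactIn (MixedTensor.invForm k D j) α) := by
  refine ⟨fun p hp α hα hd => MixedTensor.isExactIn_of_mem_exactInv
    (MixedTensor.mem_exactInv_of_lt hj hp hα hd), fun α hα hex => ?_⟩
  obtain _ | p := D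
  · omega
  · obtain ⟨β, -, rfl⟩ := hex
    exact MixedTensor.isExactIn_of_mem_exactInv (MixedTensor.mem_exactInv_top hj β hα)
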